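/- Let $X=\{1,2\}$ and let $X^*$ be the set of finite words over $X$. The first Grigorchuk group $G_0$ is the group of permutations of $X^*$ generated by the four transformations $a,b,c,d$ that fix the empty word and are defined recursively, for $w\in X^*$, by \[ a(1w)=2w,\quad a(2w)=1w;\qquad b(1w)=1\,a(w),\quad b(2w)=2\,c(w); \] \[ c(1w)=1\,a(w),\quad c(2w)=2\,d(w);\qquad d(1w)=1w,\quad d(2w)=2\,b(w). \] In a group $G$ write $[x,y]=x^{-1}y^{-1}xy$, $E_0(x,y)=x$ and $E_{c+1}(x,y)=[E_c(x,y),y]$ for $c\ge 0$. A pair $(g,h)\in G\times G$ is Engel if $E_c(g,h)=1$ for all sufficiently large $c$. The group $G$ is Engel if every pair of its elements is Engel, and an element $h\in G$ is Engel if $(g,h)$ is Engel for every $g\in G$. Theorem. The first Grigorchuk group $G_0$ is not Engel. Furthermore, an element $h\in G_0$ is Engel if and only if $h^2=1$. -/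

import Mathlib

section Engel

variable {G : Type*} [Group G]

/-- The iterated commutator `E_c(x, y) = [x, y, …, y]` (`c` copies of `y`), where
`[u, v] = u⁻¹ v⁻¹ u v`: `E_0(x, y) = x` and `E_{c+1}(x, y) = [E_c(x, y), y]`. -/
def engelWord (x y : G) : ℕ → G
  | 0 => x
  | c + 1 => (engelWord x y c)⁻¹ * y⁻¹ * engelWord x y c * y

/-- The pair `(x, y)` is Engel: `E_c(x, y) = 1` for all large enough `c`. -/
def IsEngelPair (x y : G) : Prop :=
  ∃ N : ℕ, ∀ c : ℕ, N ≤ c → engelWord x y c = 1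

/-- `h` is an Engel element of `G`: `(g, h)` is an Engel pair for every `g` in `G`. -/
def IsEngelElement (h : G) : Prop :=
  ∀ g : G, IsEngelPair g h

variable (G) in
/-- `G` is an Engel group: every pair of its elements is Engel. -/
def IsEngelGroup : Prop :=
  ∀ g h : G, IsEngelPair g h

end Engel

namespace Grigorchuk

/-- The alphabet `{1, 2}`. -/
inductive Letter where
  | one
  | two
  deriving DecidableEq

/-- The five states of the Grigorchuk automaton; `e` is the trivial state. -/
inductive State where
  | a
  | b
  | c
  | d
  | e
  deriving DecidableEq

/-- The output letter of the transition from a given state with a given input letter. -/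
def output : State → Letter → Letter
  | .a, .one => .two
  | .a, .two => .one
  | _, x => x

/-- The end point of the transition from a given state with a given input letter. -/
def next : State → Letter → State
  | .b, .one => .a
  | .b, .two => .c
  | .c, .one => .a
  | .c, .two => .d
  | .d, .one => .e
  | .d, .two => .b
  | .a, _ => .e
  | .e, _ => .e

/-- The length-preserving transformation of finite words defined by a state of the automaton. -/
def act : State → List Letter → List Letter
  | _, [] => []
  | q, x :: w => output q x :: act (next q x) w

theorem output_output (q : State) (x : Letter) : output q (output q x) = x := by
  cases q <;> cases x <;> rfl

theorem next_output (q : State) (x : Letter) : next q (output q x) = next q x := by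
  cases q <;> cases x <;> rfl

theorem act_act (q : State) (w : List Letter) : act q (act q w) = w := by
  induction w generalizing q with
  | nil => rfl
  | cons x w ih => simp only [act, output_output, next_output, ih]

/-- The permutation of the set of finite words defined by a state of the automaton. -/
def perm (q : State) : Equiv.Perm (List Letter) where
  toFun := act q
  invFun := act q
  left_inv := act_act q
  right_inv := act_act q

end Grigorchuk

/-- The first Grigorchuk group: the group of permutations of the set of finite words over
`{1, 2}` generated by the states of the Grigorchuk automaton. -/
def grigorchukGroup : Subgroup (Equiv.Perm (List Grigorchuk.Letter)) :=
  Subgroup.closure (Set.range Grigorchuk.perm)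

/-! Every element of the group has 2-power order (`isTwoTorsion_ev`), by contraction of lengths
under sections. If h² = 1, then h inverts [x, h], so E_{c+1}(x, h) = [x, h]^((-2)^c), which vanishes
for large c.

If h² ≠ 1, then h has order M = 2^(m+2), and some vertex v has an h-orbit of length M. The normal
closure K of (ab)² is branching: any element of K can be planted below any vertex, with trivial
action elsewhere (`exists_actsBelow`). Hence some g acts below hⁱv through any prescribed function F
: ℤ/4 → K (`exists_represents`), and commutation with h turns F into i ↦ F(i)⁻¹F(i+1). It remains to
find an F that this operator never kills: an explicit one leads, after commutations and sections, to
a nontrivial quadruple that reproduces itself (`run_initialQuad`, `run_periodicQuad`). -/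

namespace Grigorchuk

/-! ### Words in the states and their sections -/

/-- The permutation represented by a word in the states. -/
def ev (w : List State) : Equiv.Perm (List Letter) := (w.map perm).prod

@[simp] theorem ev_nil : ev [] = 1 := rfl

theorem ev_cons (q : State) (w : List State) : ev (q :: w) = perm q * ev w := by
  simp [ev]

theorem ev_append (u w : List State) : ev (u ++ w) = ev u * ev w := by
  simp [ev]

theorem ev_singleton (q : State) : ev [q] = perm q := by simp [ev]

@[simp] theorem perm_apply (q : State) (u : List Letter) : perm q u = act q u := rfl

theorem perm_mul_self (q : State) : perm q * perm q = 1 := by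
  ext1 u; exact act_act q u

theorem perm_inv (q : State) : (perm q)⁻¹ = perm q :=
  inv_eq_of_mul_eq_one_left (perm_mul_self q)

theorem ev_reverse (w : List State) : ev w.reverse = (ev w)⁻¹ := by
  induction w with
  | nil => simp
  | cons q w ih => simp [ev_append, ev_cons, ih, perm_inv]

theorem ev_mem (w : List State) : ev w ∈ grigorchukGroup :=
  Subgroup.list_prod_mem _ fun x hx => by
    obtain ⟨q, -, rfl⟩ := List.mem_map.1 hx
    exact Subgroup.subset_closure ⟨q, rfl⟩

theorem exists_ev {g : Equiv.Perm (List Letter)} (hg : g ∈ grigorchukGroup) :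
    ∃ w, ev w = g := by
  induction hg using Subgroup.closure_induction with
  | mem x hx => obtain ⟨q, rfl⟩ := hx; exact ⟨[q], ev_singleton q⟩
  | one => exact ⟨[], rfl⟩
  | mul x y _ _ hx hy =>
    obtain ⟨u, rfl⟩ := hx
    obtain ⟨w, rfl⟩ := hy
    exact ⟨u ++ w, ev_append u w⟩
  | inv x _ hx => obtain ⟨u, rfl⟩ := hx; exact ⟨u.reverse, ev_reverse u⟩

/-- The action of a word in the states on letters. -/
def wordOut : List State → Letter → Letter
  | [], x => x
  | q :: w, x => output q (wordOut w x)

/-- The section of a word in the states at a letter. -/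
def wordNext : List State → Letter → List State
  | [], _ => []
  | q :: w, x => next q (wordOut w x) :: wordNext w x

theorem ev_apply_nil (w : List State) : ev w [] = [] := by
  induction w with
  | nil => rfl
  | cons q w ih => simp [ev_cons, ih, act]

theorem ev_apply_cons (w : List State) (x : Letter) (u : List Letter) :
    ev w (x :: u) = wordOut w x :: ev (wordNext w x) u := by
  induction w with
  | nil => rfl
  | cons q w ih => simp [ev_cons, ih, act, wordOut, wordNext]

theorem wordOut_append (u w : List State) (x : Letter) :
    wordOut (u ++ w) x = wordOut u (wordOut w x) := by
  induction u with
  | nil => rfl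
  | cons q u ih => simp [wordOut, ih]

theorem wordNext_append (u w : List State) (x : Letter) :
    wordNext (u ++ w) x = wordNext u (wordOut w x) ++ wordNext w x := by
  induction u with
  | nil => rfl
  | cons q u ih => simp [wordOut_append, wordNext, ih]

/-- The other letter. -/
def swap : Letter → Letter
  | .one => .two
  | .two => .one

theorem swap_one : swap .one = .two := rfl

theorem swap_two : swap .two = .one := rfl

theorem output_swap (q : State) (x : Letter) : output q (swap x) = swap (output q x) := by
  cases q <;> cases x <;> rfl

theorem swap_swap (x : Letter) : swap (swap x) = x := by cases x <;> rfl

theorem eq_or_eq_swap (x y : Letter) : y = x ∨ y = swap x := by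
  cases x <;> cases y <;> simp [swap]

theorem wordOut_swap (w : List State) (x : Letter) :
    wordOut w (swap x) = swap (wordOut w x) := by
  induction w with
  | nil => rfl
  | cons q w ih => simp [wordOut, ih, output_swap]

theorem wordOut_eq_self {w : List State} {x : Letter} (h : wordOut w x = x) (y : Letter) :
    wordOut w y = y := by
  rcases eq_or_eq_swap x y with rfl | rfl
  · exact h
  · rw [wordOut_swap, h]

theorem act_e (u : List Letter) : act .e u = u := by
  induction u with
  | nil => rfl
  | cons x u ih => simp [act, output, next, ih]

theorem perm_e : perm .e = 1 := by
  ext1 u; exact act_e u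

/-! ### Klein four-group relations and reduction of words -/

/-- The product of two states in the Klein four-group `{e, b, c, d}`. -/
def kleinMul : State → State → State
  | .e, q => q
  | p, .e => p
  | .b, .c => .d
  | .c, .b => .d
  | .b, .d => .c
  | .d, .b => .c
  | .c, .d => .b
  | .d, .c => .b
  | _, _ => .e

theorem act_kleinMul (u : List Letter) (p q : State) (hp : p ≠ .a) (hq : q ≠ .a) :
    act p (act q u) = act (kleinMul p q) u := by
  induction u generalizing p q with
  | nil => rfl
  | cons x u ih =>
    cases p <;> cases q <;> cases x <;>
      first
      | exact absurd rfl hp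
      | exact absurd rfl hq
      | simp [act, output, next, kleinMul, act_e, act_act, ih]

theorem perm_kleinMul (p q : State) (hp : p ≠ .a) (hq : q ≠ .a) :
    perm p * perm q = perm (kleinMul p q) := by
  ext1 u; exact act_kleinMul u p q hp hq

/-- Multiply a reduced word by a state on the left. -/
def push : State → List State → List State
  | .e, w => w
  | q, [] => [q]
  | .a, p :: w => if p = .a then w else .a :: p :: w
  | q, p :: w =>
    if p = .a then q :: p :: w else if kleinMul q p = .e then w else kleinMul q p :: w

/-- Reduction of a word in the free product of the groups `{e, a}` and `{e, b, c, d}`. -/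
def reduce (w : List State) : List State := w.foldr push []

theorem ev_push (q : State) (w : List State) : ev (push q w) = perm q * ev w := by
  have klein (q p : State) (w : List State) (hq : q ≠ .a) :
      ev (if p = .a then q :: p :: w else if kleinMul q p = .e then w else kleinMul q p :: w) =
        perm q * ev (p :: w) := by
    split_ifs with hp h
    · rw [ev_cons]
    · rw [ev_cons, ← mul_assoc, perm_kleinMul q p hq hp, h, perm_e, one_mul]
    · rw [ev_cons, ev_cons, ← mul_assoc, perm_kleinMul q p hq hp]
  cases q <;> cases w
  case a.cons p w =>
    rw [push]
    split_ifs with h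
    · rw [h, ev_cons, ← mul_assoc, perm_mul_self, one_mul]
    · rw [ev_cons]
  case b.cons p w => exact klein .b p w (by simp)
  case c.cons p w => exact klein .c p w (by simp)
  case d.cons p w => exact klein .d p w (by simp)
  all_goals simp [push, ev_cons, perm_e]

theorem ev_reduce (w : List State) : ev (reduce w) = ev w := by
  induction w with
  | nil => rfl
  | cons q w ih => rw [reduce, List.foldr_cons, ev_push, ← reduce, ih, ev_cons]


/-! ### Torsion: every element has 2-power order -/

/-- `g` has order a power of two. -/
def IsTwoTorsion {G : Type*} [Group G] (g : G) : Prop := ∃ k : ℕ, g ^ 2 ^ k = 1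

theorem IsTwoTorsion.of_sq {G : Type*} [Group G] {g : G} (h : IsTwoTorsion (g * g)) :
    IsTwoTorsion g := by
  obtain ⟨k, hk⟩ := h
  refine ⟨k + 1, ?_⟩
  rw [pow_succ', pow_mul, sq, hk]

theorem IsTwoTorsion.of_conj {G : Type*} [Group G] {g p : G}
    (h : IsTwoTorsion (p⁻¹ * g * p)) : IsTwoTorsion g := by
  obtain ⟨k, hk⟩ := h
  refine ⟨k, ?_⟩
  have := conj_pow (i := 2 ^ k) (a := p⁻¹) (b := g)
  rw [inv_inv, hk] at this
  rw [← mul_left_cancel_iff (a := p⁻¹), ← mul_right_cancel_iff (a := p), ← this]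
  simp

theorem IsTwoTorsion.pow_eq_one {G : Type*} [Group G] {g : G} {k l : ℕ} (h : g ^ 2 ^ k = 1)
    (hkl : k ≤ l) : g ^ 2 ^ l = 1 := by
  obtain ⟨m, rfl⟩ := Nat.exists_eq_add_of_le hkl
  rw [pow_add, pow_mul, h, one_pow]

theorem ev_pow_apply_cons {w : List State} {x : Letter} (h : wordOut w x = x) (n : ℕ)
    (u : List Letter) : (ev w ^ n) (x :: u) = x :: (ev (wordNext w x) ^ n) u := by
  induction n with
  | zero => rfl
  | succ n ih => rw [pow_succ', pow_succ', Equiv.Perm.mul_apply, ih, ev_apply_cons, h]; rfl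

theorem ev_pow_apply_nil (w : List State) (n : ℕ) : (ev w ^ n) [] = [] := by
  induction n with
  | zero => rfl
  | succ n ih => rw [pow_succ', Equiv.Perm.mul_apply, ih, ev_apply_nil]

theorem isTwoTorsion_of_sections {w : List State} (h : ∀ x, wordOut w x = x)
    (ht : ∀ x, IsTwoTorsion (ev (wordNext w x))) : IsTwoTorsion (ev w) := by
  obtain ⟨k, hk⟩ := ht .one
  obtain ⟨l, hl⟩ := ht .two
  refine ⟨max k l, Equiv.ext fun u => ?_⟩
  cases u with
  | nil => exact ev_pow_apply_nil w _
  | cons x u =>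
    rw [ev_pow_apply_cons (h x)]
    cases x
    · rw [IsTwoTorsion.pow_eq_one hk (le_max_left k l)]; rfl
    · rw [IsTwoTorsion.pow_eq_one hl (le_max_right k l)]; rfl

/-- The number of letters `b`, `c`, `d` in a word. -/
def kleinCount (w : List State) : ℕ := w.countP fun q => q ≠ .a ∧ q ≠ .e

theorem kleinCount_cons (q : State) (w : List State) :
    kleinCount (q :: w) = kleinCount w + if q = .a ∨ q = .e then 0 else 1 := by
  cases q <;> simp [kleinCount]

/-- The section of a word, without trivial states. -/
def cleanSection (w : List State) (x : Letter) : List State := (wordNext w x).filter (· ≠ .e)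

theorem ev_filter (w : List State) : ev (w.filter (· ≠ .e)) = ev w := by
  induction w with
  | nil => rfl
  | cons q w ih =>
    by_cases h : q = .e
    · simp_all [ev_cons, perm_e]
    · rw [List.filter_cons_of_pos (by simpa using h), ev_cons, ev_cons, ih]

theorem cleanSection_cons (q : State) (w : List State) (x : Letter) :
    cleanSection (q :: w) x =
      if next q (wordOut w x) = .e then cleanSection w x
      else next q (wordOut w x) :: cleanSection w x := by
  simp only [cleanSection, wordNext, List.filter_cons]
  split_ifs <;> simp_all

theorem length_cleanSection_le (w : List State) (x : Letter) :
    (cleanSection w x).length ≤ kleinCount w := by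
  induction w with
  | nil => simp [cleanSection, wordNext]
  | cons q w ih =>
    rw [cleanSection_cons]
    rw [kleinCount_cons]
    cases q <;> generalize wordOut w x = y <;> cases y <;> simp [next] <;> omega

/-- Each `b` or `c` leaves a letter in both sections, `d` in only one of them, and `a` in neither.
-/
theorem length_cleanSection_add (w : List State) (x : Letter) :
    (cleanSection w x).length + (cleanSection w (swap x)).length + w.count .d ≤ 2 * kleinCount w := by
  induction w with
  | nil => simp [cleanSection, wordNext]
  | cons q w ih =>
    rw [cleanSection_cons, cleanSection_cons, wordOut_swap]
    rw [kleinCount_cons, List.count_cons]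
    cases q <;> generalize wordOut w x = y <;> cases y <;> simp [next, swap_one, swap_two] <;> omega

/-- At each position of the word the two sections read opposite letters, so exactly one of them
reads `two` there. -/
theorem next_mem_cleanSection {w : List State} {p q : State} (hp : p ∈ w) (hq : q ≠ .e)
    (h : next p .two = q) (x : Letter) : q ∈ cleanSection w (swap x) ++ cleanSection w x := by
  induction w with
  | nil => simp at hp
  | cons r w ih =>
    rw [cleanSection_cons, cleanSection_cons, wordOut_swap]
    rcases List.mem_cons.1 hp with rfl | hp
    · generalize wordOut w x = y
      subst h
      cases y <;> simp [swap_one, swap_two, hq]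
    · have := ih hp
      simp only [List.mem_append] at this ⊢
      split_ifs <;> grind

theorem kleinCount_le (w : List State) : kleinCount w ≤ w.countP (· ≠ .a) :=
  List.countP_mono_left fun q _ hq => by simp_all

/-- A word is not the shortest for its value unless it almost alternates. -/
theorem exists_shorter_or_count_le (w : List State) :
    (∃ w' : List State, w'.length < w.length ∧ ev w' = ev w) ∨
      w.countP (· ≠ .a) ≤
        w.count .a + if w.head?.any (· ≠ .a) then 1 else 0 := by
  induction w with
  | nil => right; simp
  | cons p u ih =>
    rcases ih with ⟨w', h1, h2⟩ | h
    · exact Or.inl ⟨p :: w', by simpa using h1, by rw [ev_cons, ev_cons, h2]⟩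
    by_cases hp : p = .a
    · right
      subst hp
      simp only [List.countP_cons, List.count_cons]
      simp only [List.head?_cons, Option.any_some]
      simp
      split_ifs at h <;> simp at h <;> omega
    cases u with
    | nil => right; simp [hp]
    | cons q u =>
      by_cases hq : q = .a
      · right
        simp [hp, hq] at h ⊢
        omega
      · left
        refine ⟨kleinMul p q :: u, by simp, ?_⟩
        rw [ev_cons, ev_cons, ev_cons, ← mul_assoc, perm_kleinMul p q hp hq]

/-- Up to conjugation and shortening, at least half of the letters of a word are `a`. -/
theorem isTwoTorsion_of_balanced {w : List State}
    (hs : ∀ w' : List State, w'.length < w.length → IsTwoTorsion (ev w'))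
    (H : ∀ w' : List State, w'.length = w.length → (∀ q ∈ w, q ∈ w') →
      w'.countP (· ≠ .a) ≤ w'.count .a → IsTwoTorsion (ev w')) : IsTwoTorsion (ev w) := by
  have key (w' : List State) (hl : w'.length = w.length) (hm : ∀ q ∈ w, q ∈ w')
      (ha : w'.head?.any (· ≠ .a) = false) : IsTwoTorsion (ev w') := by
    rcases exists_shorter_or_count_le w' with ⟨w'', h1, h2⟩ | h
    · exact h2 ▸ hs w'' (hl ▸ h1)
    · exact H w' hl hm (by rw [ha] at h; simpa using h)
  cases w with
  | nil => exact ⟨0, by simp⟩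
  | cons p u =>
    by_cases hp : p = .a
    · exact key _ rfl (fun _ h => h) (by simp [hp])
    cases u with
    | nil => exact IsTwoTorsion.of_sq ⟨0, by simp [ev_singleton, perm_mul_self]⟩
    | cons q u =>
      by_cases hq : q = .a
      -- Conjugation by the first letter moves it to the end, so that the word starts with `a`.
      · refine IsTwoTorsion.of_conj (p := perm p) ?_
        have := key (q :: u ++ [p]) (by simp) (by simp; tauto) (by simp [hq])
        rwa [ev_append, ev_singleton, ← one_mul (ev (q :: u)), ← inv_mul_cancel (perm p),
          mul_assoc (perm p)⁻¹, ← ev_cons] at this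
      · have := hs (kleinMul p q :: u) (by simp)
        rwa [ev_cons, ← perm_kleinMul p q hp hq, mul_assoc, ← ev_cons, ← ev_cons] at this

/-- In a balanced word at most half of the letters leave anything in a section. If the word fixes
the letters, its sections are shorter. Otherwise its square does, with the product of the two
sections as section: no longer than the word, shorter if `d` occurs, and with `c`, `b` giving rise
to `d`, `c`. -/
theorem isTwoTorsion_of_forall {w : List State}
    (hs : ∀ w' : List State, w'.length < w.length → IsTwoTorsion (ev w'))
    (H : ∀ w' : List State, w'.length ≤ w.length → (.c ∈ w → .d ∈ w') → (.b ∈ w → .c ∈ w') →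
      (.d ∈ w → w'.length < w.length) → IsTwoTorsion (ev w')) : IsTwoTorsion (ev w) := by
  refine isTwoTorsion_of_balanced hs fun v hl hm hv => ?_
  have hlen : v.length = v.count .a + v.countP (· ≠ .a) := by
    rw [List.length_eq_countP_add_countP (· == State.a), List.count]
    congr 2
    ext q; simp
  have hk := kleinCount_le v
  rcases Nat.eq_zero_or_pos v.length with h0 | h0
  · rw [List.length_eq_zero_iff.1 h0]; exact ⟨0, by simp⟩
  by_cases hfix : wordOut v .one = .one
  · refine isTwoTorsion_of_sections (wordOut_eq_self hfix) fun x => ?_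
    rw [← ev_filter]
    refine hs _ ((length_cleanSection_le v x).trans_lt ?_)
    omega
  · have hswap (x : Letter) : wordOut v x = swap x := by
      rcases eq_or_eq_swap x (wordOut v x) with h | h
      · exact absurd (wordOut_eq_self h .one) hfix
      · exact h
    refine IsTwoTorsion.of_sq ?_
    rw [← ev_append]
    refine isTwoTorsion_of_sections (fun x => ?_) fun x => ?_
    · rw [wordOut_append, hswap, hswap, swap_swap]
    · have hadd := length_cleanSection_add v x
      rw [wordNext_append, hswap, ← ev_filter, List.filter_append]
      refine H _ ?_ (fun h => next_mem_cleanSection (hm _ h) State.noConfusion rfl x)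
        (fun h => next_mem_cleanSection (hm _ h) State.noConfusion rfl x) fun h => ?_
      · rw [List.length_append, ← cleanSection, ← cleanSection]
        omega
      · have := List.count_pos_iff.2 (hm _ h)
        rw [List.length_append, ← cleanSection, ← cleanSection]
        omega

/-- Squaring and taking sections turns `b` into `c`, `c` into `d`, and an occurrence of `d` shortens
the word; so the length drops within three rounds. -/
theorem isTwoTorsion_ev (w : List State) : IsTwoTorsion (ev w) := by
  induction hn : w.length using Nat.strong_induction_on generalizing w with
  | _ n ih =>
    have hs (w' : List State) (h : w'.length < n) : IsTwoTorsion (ev w') := ih _ h w' rfl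
    have hd (w : List State) (hw : w.length ≤ n) (h : .d ∈ w) : IsTwoTorsion (ev w) :=
      isTwoTorsion_of_forall (fun w' h => hs w' (h.trans_le hw))
        fun w' _ _ _ hl => hs w' ((hl h).trans_le hw)
    have hc (w : List State) (hw : w.length ≤ n) (h : .c ∈ w) : IsTwoTorsion (ev w) :=
      isTwoTorsion_of_forall (fun w' h => hs w' (h.trans_le hw))
        fun w' hl hd' _ _ => hd w' (hl.trans hw) (hd' h)
    have hb (w : List State) (hw : w.length ≤ n) (h : .b ∈ w) : IsTwoTorsion (ev w) :=
      isTwoTorsion_of_forall (fun w' h => hs w' (h.trans_le hw))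
        fun w' hl _ hc' _ => hc w' (hl.trans hw) (hc' h)
    by_cases h : .b ∈ w ∨ .c ∈ w ∨ .d ∈ w
    · rcases h with h | h | h
      exacts [hb w hn.le h, hc w hn.le h, hd w hn.le h]
    · have (w : List State) (h : ¬(.b ∈ w ∨ .c ∈ w ∨ .d ∈ w)) : ev w = 1 ∨ ev w = perm .a := by
        induction w with
        | nil => exact Or.inl rfl
        | cons q w ih =>
          rw [ev_cons]
          cases q <;> simp at h
          · rcases ih (by tauto) with h | h <;> simp [h, perm_mul_self]
          · rcases ih (by tauto) with h | h <;> simp [h, perm_e]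
      rcases this w h with h | h
      · exact ⟨0, by simp [h]⟩
      · exact ⟨1, by simp [h, sq, perm_mul_self]⟩

theorem isTwoTorsion_of_mem {g : Equiv.Perm (List Letter)} (hg : g ∈ grigorchukGroup) :
    IsTwoTorsion g := by
  obtain ⟨w, rfl⟩ := exists_ev hg
  exact isTwoTorsion_ev w

end Grigorchuk

/-! ### Involutions are Engel -/

/-- Commutation with an involution `h` inverts the elements `[x, h]`. -/
theorem engelWord_succ_of_sq_eq_one {G : Type*} [Group G] {h : G} (hh : h ^ 2 = 1) (x : G)
    (c : ℕ) : engelWord x h (c + 1) = engelWord x h 1 ^ ((-2 : ℤ) ^ c) := by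
  have hi : h⁻¹ = h := inv_eq_of_mul_eq_one_left (by rw [← sq, hh])
  have hconj : h⁻¹ * engelWord x h 1 * h = (engelWord x h 1)⁻¹ := by
    simp only [engelWord, hi, mul_inv_rev, inv_inv]
    simp [mul_assoc, ← sq, hh]
  induction c with
  | zero => simp
  | succ c ih =>
    -- If h inverts y, then [y, h] = y⁻¹ · y⁻¹ = y⁻²; here y is a power of [x, h].
    have hz := conj_zpow (i := (-2 : ℤ) ^ c) (a := h⁻¹) (b := engelWord x h 1)
    rw [inv_inv, hconj] at hz
    rw [engelWord, ih, mul_assoc (_ * _), mul_assoc, ← mul_assoc _ _ h, ← hz, inv_zpow, ← mul_inv_rev, ← zpow_add, ← zpow_neg]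
    congr 1
    ring

theorem isEngelElement_of_sq_eq_one {h : grigorchukGroup} (hh : h ^ 2 = 1) :
    IsEngelElement h := by
  intro g
  obtain ⟨k, hk⟩ := Grigorchuk.isTwoTorsion_of_mem (engelWord g h 1).2
  have hk' : engelWord g h 1 ^ 2 ^ k = 1 := Subtype.ext (by simpa using hk)
  refine ⟨k + 1, fun c hc => ?_⟩
  obtain ⟨m, rfl⟩ := Nat.exists_eq_add_of_le hc
  rw [show k + 1 + m = (k + m) + 1 by ring, engelWord_succ_of_sq_eq_one hh]
  rw [show (-2 : ℤ) ^ (k + m) = ((2 ^ k : ℕ) : ℤ) * ((-1) ^ k * (-2) ^ m) by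
    push_cast; rw [pow_add, neg_pow 2 k]; ring, zpow_mul, zpow_natCast, hk', one_zpow]


namespace Grigorchuk

/-! ### The branching subgroup -/

theorem apply_inv_self {α : Type*} (g : Equiv.Perm α) (x : α) : g (g⁻¹ x) = x :=
  g.apply_symm_apply x

theorem inv_apply_self {α : Type*} (g : Equiv.Perm α) (x : α) : g⁻¹ (g x) = x :=
  g.symm_apply_apply x

theorem ev_apply_append (w : List State) (v : List Letter) :
    ∃ w', ∀ u, ev w (v ++ u) = ev w v ++ ev w' u := by
  induction v generalizing w with
  | nil => exact ⟨w, fun u => by simp [ev_apply_nil]⟩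
  | cons x v ih =>
    obtain ⟨w', hw'⟩ := ih (wordNext w x)
    exact ⟨w', fun u => by simp [ev_apply_cons, hw']⟩

theorem length_ev (w : List State) (v : List Letter) : (ev w v).length = v.length := by
  induction v generalizing w with
  | nil => simp [ev_apply_nil]
  | cons x v ih => simp [ev_apply_cons, ih]

/-- The subtree below v goes to the subtree below s(v), a different vertex of the same level. -/
theorem not_prefix_apply {s : Equiv.Perm (List Letter)} (hs : s ∈ grigorchukGroup)
    {v : List Letter} (hv : s v ≠ v) (u : List Letter) : ¬ v <+: s (v ++ u) := by
  obtain ⟨w, rfl⟩ := exists_ev hs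
  obtain ⟨w', hw'⟩ := ev_apply_append w v
  rw [hw']
  rintro ⟨t, ht⟩
  exact hv (List.append_inj ht (length_ev w v).symm).1.symm

/-- The element `(ab)²`. -/
def branchWord : List State := [.a, .b, .a, .b]

/-- The subgroup generated by the conjugates of `(ab)²` in the Grigorchuk group. -/
def branchSubgroup : Subgroup (Equiv.Perm (List Letter)) :=
  Subgroup.closure {g | ∃ p ∈ grigorchukGroup, g = p * ev branchWord * p⁻¹}

theorem ev_branchWord_mem : ev branchWord ∈ branchSubgroup :=
  Subgroup.subset_closure ⟨1, one_mem _, by simp⟩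

theorem branchSubgroup_le : branchSubgroup ≤ grigorchukGroup := by
  rw [branchSubgroup, Subgroup.closure_le]
  rintro _ ⟨p, hp, rfl⟩
  exact mul_mem (mul_mem hp (ev_mem _)) (inv_mem hp)

theorem conj_mem_branchSubgroup {p k : Equiv.Perm (List Letter)} (hp : p ∈ grigorchukGroup)
    (hk : k ∈ branchSubgroup) : p * k * p⁻¹ ∈ branchSubgroup := by
  induction hk using Subgroup.closure_induction with
  | mem x hx =>
    obtain ⟨q, hq, rfl⟩ := hx
    exact Subgroup.subset_closure ⟨p * q, mul_mem hp hq, by group⟩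
  | one => simp
  | mul x y _ _ hx hy =>
    rw [← conj_mul]
    exact mul_mem hx hy
  | inv x _ hx =>
    rw [← conj_inv]
    exact inv_mem hx

/-- `g` acts as `k` below the vertex `v` and trivially elsewhere. -/
def ActsBelow (v : List Letter) (g k : Equiv.Perm (List Letter)) : Prop :=
  (∀ u, g (v ++ u) = v ++ k u) ∧ ∀ w, ¬ v <+: w → g w = w

theorem ActsBelow.mul {v : List Letter} {g g' k k' : Equiv.Perm (List Letter)}
    (h : ActsBelow v g k) (h' : ActsBelow v g' k') : ActsBelow v (g * g') (k * k') :=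
  ⟨fun u => by simp [h.1, h'.1], fun w hw => by simp [h.2 w hw, h'.2 w hw]⟩

theorem ActsBelow.inv {v : List Letter} {g k : Equiv.Perm (List Letter)}
    (h : ActsBelow v g k) : ActsBelow v g⁻¹ k⁻¹ :=
  ⟨fun u => by rw [Equiv.Perm.inv_eq_iff_eq, h.1, apply_inv_self],
    fun w hw => by rw [Equiv.Perm.inv_eq_iff_eq, h.2 w hw]⟩

/-- A word that fixes letters and has the given state as section at the given letter. -/
def liftState : State → Letter → List State
  | .e, _ => []
  | .a, .one => [.b]
  | .a, .two => [.a, .b, .a]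
  | .c, .one => [.a, .b, .a]
  | .d, .one => [.a, .c, .a]
  | .b, .one => [.a, .d, .a]
  | .c, .two => [.b]
  | .d, .two => [.c]
  | .b, .two => [.d]

/-- Self-replication: the stabilizer of the first level projects onto the group at each letter,
which need only be checked on the states. -/
theorem exists_lift (w : List State) (x : Letter) :
    ∃ w', wordOut w' x = x ∧ ev (wordNext w' x) = ev w := by
  induction w with
  | nil => exact ⟨[], rfl, rfl⟩
  | cons q w ih =>
    obtain ⟨w', h1, h2⟩ := ih
    refine ⟨liftState q x ++ w', ?_, ?_⟩
    · rw [wordOut_append, h1]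
      cases q <;> cases x <;> rfl
    · rw [wordNext_append, h1, ev_append, h2, ev_cons]
      congr 1
      cases q <;> cases x <;> simp [liftState, wordNext, wordOut, next, output, ev_cons, perm_e]

theorem actsBelow_singleton {w : List State} {x : Letter} {k : Equiv.Perm (List Letter)}
    (h : wordOut w x = x) (h1 : ev (wordNext w x) = k) (h2 : ev (wordNext w (swap x)) = 1) :
    ActsBelow [x] (ev w) k := by
  refine ⟨fun u => by simp [ev_apply_cons, h, h1], fun v hv => ?_⟩
  cases v with
  | nil => exact ev_apply_nil w
  | cons y v =>
    rcases eq_or_eq_swap x y with rfl | rfl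
    · exact absurd ⟨v, rfl⟩ hv
    · rw [ev_apply_cons, h2, wordOut_swap, h]; rfl

/-- A word for the element that acts as `(ab)²` below the vertex `2`. -/
def branchLift : List State :=
  [.b] ++ branchWord.reverse ++ ([.d] ++ branchWord ++ [.d]) ++ [.b]

/-- In terms of sections at 1 and 2, (ab)² = (ca, ac) and d = (1, b), so [(ab)², d] = (1, cabad);
conjugation by b = (a, c) turns this into (1, (ab)²). -/
theorem ev_branchLift_mem : ev branchLift ∈ branchSubgroup := by
  have h : ev branchLift =
      ev [.b] * ((ev branchWord)⁻¹ * (ev [.d] * ev branchWord * (ev [.d])⁻¹)) * (ev [.b])⁻¹ := by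
    simp only [branchLift, ev_append, ev_reverse, ev_singleton, perm_inv, mul_assoc]
  rw [h]
  exact conj_mem_branchSubgroup (ev_mem _) (mul_mem (inv_mem ev_branchWord_mem)
    (conj_mem_branchSubgroup (ev_mem _) ev_branchWord_mem))

theorem ev_eq_of_reduce_eq {u w : List State} (h : reduce u = reduce w) : ev u = ev w := by
  rw [← ev_reduce, h, ev_reduce]

theorem exists_actsBelow_branchWord (x : Letter) :
    ∃ g ∈ branchSubgroup, ActsBelow [x] g (ev branchWord) := by
  cases x
  · refine ⟨ev ([.a] ++ branchLift ++ [.a]), ?_,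
      actsBelow_singleton rfl (ev_eq_of_reduce_eq rfl) (ev_eq_of_reduce_eq (w := []) rfl)⟩
    rw [ev_append, ev_append]
    nth_rewrite 2 [ev_singleton]
    rw [← perm_inv, ← ev_singleton]
    exact conj_mem_branchSubgroup (ev_mem _) ev_branchLift_mem
  · exact ⟨ev branchLift, ev_branchLift_mem,
      actsBelow_singleton rfl (ev_eq_of_reduce_eq rfl) (ev_eq_of_reduce_eq (w := []) rfl)⟩

/-- A generator p(ab)²p⁻¹ is planted by conjugating the planted (ab)² by an element that fixes x and
has section p there. -/
theorem exists_actsBelow_letter {k : Equiv.Perm (List Letter)} (hk : k ∈ branchSubgroup)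
    (x : Letter) : ∃ g ∈ branchSubgroup, ActsBelow [x] g k := by
  induction hk using Subgroup.closure_induction with
  | mem k hk =>
    obtain ⟨p, hp, rfl⟩ := hk
    obtain ⟨w, rfl⟩ := exists_ev hp
    obtain ⟨w', h1, h2⟩ := exists_lift w x
    obtain ⟨g, hg, hgx⟩ := exists_actsBelow_branchWord x
    have hinv (v : List Letter) : (ev w')⁻¹ (x :: v) = x :: (ev w)⁻¹ v := by
      rw [Equiv.Perm.inv_eq_iff_eq, ev_apply_cons, h1, h2, apply_inv_self]
    refine ⟨_, conj_mem_branchSubgroup (ev_mem w') hg, fun u => ?_, fun v hv => ?_⟩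
    · have := hgx.1 ((ev w)⁻¹ u)
      simp only [List.singleton_append] at this
      simp only [Equiv.Perm.mul_apply, List.singleton_append, hinv, this, ev_apply_cons, h1, h2]
    · have : ¬ [x] <+: (ev w')⁻¹ v := by
        rintro ⟨u, hu⟩
        apply hv
        rw [List.singleton_append, Equiv.Perm.eq_inv_iff_eq, ev_apply_cons, h1] at hu
        exact ⟨_, hu⟩
      rw [Equiv.Perm.mul_apply, Equiv.Perm.mul_apply, hgx.2 _ this, apply_inv_self]
  | one => exact ⟨1, one_mem _, fun _ => rfl, fun _ _ => rfl⟩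
  | mul k k' _ _ h h' =>
    obtain ⟨g, hg, hgx⟩ := h
    obtain ⟨g', hg', hgx'⟩ := h'
    exact ⟨_, mul_mem hg hg', hgx.mul hgx'⟩
  | inv k _ h =>
    obtain ⟨g, hg, hgx⟩ := h
    exact ⟨_, inv_mem hg, hgx.inv⟩

theorem exists_actsBelow {k : Equiv.Perm (List Letter)} (hk : k ∈ branchSubgroup)
    (v : List Letter) : ∃ g ∈ branchSubgroup, ActsBelow v g k := by
  induction v with
  | nil => exact ⟨k, hk, fun _ => rfl, fun _ h => absurd (List.nil_prefix) h⟩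
  | cons x v ih =>
    obtain ⟨g, hg, hgv⟩ := ih
    obtain ⟨g', hg', hgx⟩ := exists_actsBelow_letter hg x
    refine ⟨g', hg', fun u => ?_, fun w hw => ?_⟩
    · have := hgx.1 (v ++ u)
      simpa [hgv.1] using this
    · by_cases hx : [x] <+: w
      · obtain ⟨u, rfl⟩ := hx
        rw [hgx.1, hgv.2]
        intro hvu
        exact hw (by simpa using hvu)
      · exact hgx.2 w hx


/-! ### Iterated commutators in the wreath product -/

/-- The commutator with a cyclic shift, on functions supported on the base of a wreath product
with a cyclic group of order four. -/
def shiftQuot {G : Type*} [Group G] (F : ZMod 4 → G) : ZMod 4 → G :=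
  fun i => (F i)⁻¹ * F (i + 1)

theorem shiftQuot_one {G : Type*} [Group G] : shiftQuot (1 : ZMod 4 → G) = 1 := by
  ext i; simp [shiftQuot]

/-- The truncated `c - 1` is harmless: for c = 0 the function is already 1, and so is its quotient.
-/
theorem iterate_shiftQuot_pred {G : Type*} [Group G] {F : ZMod 4 → G} {c : ℕ}
    (h : shiftQuot^[c] F = 1) : shiftQuot^[c - 1] (shiftQuot F) = 1 := by
  cases c with
  | zero => rw [show F = 1 from h]; exact shiftQuot_one
  | succ c => exact h

theorem inv_apply_cons {g g' : Equiv.Perm (List Letter)} {x : Letter}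
    (h : ∀ u, g (x :: u) = x :: g' u) (u : List Letter) : g⁻¹ (x :: u) = x :: g'⁻¹ u := by
  rw [Equiv.Perm.inv_eq_iff_eq, h, apply_inv_self]

/-- Sections at a fixed letter are multiplicative, so they commute with `shiftQuot`, and triviality
descends to them. -/
theorem iterate_shiftQuot_section {F F' : ZMod 4 → Equiv.Perm (List Letter)} {x : Letter}
    (h : ∀ i u, F i (x :: u) = x :: F' i u) {c : ℕ} (hc : shiftQuot^[c] F = 1) :
    shiftQuot^[c] F' = 1 := by
  induction c generalizing F F' with
  | zero =>
    ext1 i; ext1 u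
    have := h i u
    rw [show F = 1 from hc] at this
    exact (List.cons_injective this).symm
  | succ c ih =>
    refine ih (F := shiftQuot F) (fun i u => ?_) hc
    rw [shiftQuot, Equiv.Perm.mul_apply, h, inv_apply_cons (h i)]
    rfl

/-- A function from `ZMod 4` to words. -/
abbrev Quad := List State × List State × List State × List State

/-- The permutations represented by four words. -/
def Quad.toFun (q : Quad) : ZMod 4 → Equiv.Perm (List Letter) :=
  ![ev q.1, ev q.2.1, ev q.2.2.1, ev q.2.2.2]

/-- `shiftQuot` on words. -/
def Quad.shiftQuot (q : Quad) : Quad :=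
  (reduce (q.1.reverse ++ q.2.1), reduce (q.2.1.reverse ++ q.2.2.1),
    reduce (q.2.2.1.reverse ++ q.2.2.2), reduce (q.2.2.2.reverse ++ q.1))

/-- The sections of four words at a letter. -/
def Quad.sections (x : Letter) (q : Quad) : Quad :=
  (reduce (wordNext q.1 x), reduce (wordNext q.2.1 x), reduce (wordNext q.2.2.1 x),
    reduce (wordNext q.2.2.2 x))

theorem forall_zmod_four {P : ZMod 4 → Prop} (h0 : P 0) (h1 : P 1) (h2 : P 2) (h3 : P 3)
    (i : ZMod 4) : P i := by
  change Fin 4 at i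
  fin_cases i
  exacts [h0, h1, h2, h3]

theorem Quad.toFun_shiftQuot (q : Quad) :
    q.shiftQuot.toFun = Grigorchuk.shiftQuot q.toFun := by
  funext i
  have h (u w : List State) : ev (reduce (u.reverse ++ w)) = (ev u)⁻¹ * ev w := by
    rw [ev_reduce, ev_append, ev_reverse]
  revert i
  exact forall_zmod_four (h _ _) (h _ _) (h _ _) (h _ _)

/-- Apply to four words a sequence of operations: `none` for `shiftQuot` and `some x` for the
section at `x`, which has to be fixed by all the words. -/
def Quad.run : List (Option Letter) → Quad → Option Quad
  | [], q => some q
  | none :: l, q => run l q.shiftQuot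
  | some x :: l, q =>
    if wordOut q.1 x = x ∧ wordOut q.2.1 x = x ∧ wordOut q.2.2.1 x = x ∧ wordOut q.2.2.2 x = x
    then run l (q.sections x) else none

theorem Quad.iterate_shiftQuot_run {l : List (Option Letter)} {q q' : Quad}
    (h : q.run l = some q') {c : ℕ} (hc : Grigorchuk.shiftQuot^[c] q.toFun = 1) :
    Grigorchuk.shiftQuot^[c - l.count none] q'.toFun = 1 := by
  induction l generalizing q c with
  | nil => cases h; exact hc
  | cons o l ih =>
    cases o with
    | none =>
      have := ih (q := q.shiftQuot) h (c := c - 1)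
        (by rw [Quad.toFun_shiftQuot]; exact iterate_shiftQuot_pred hc)
      rwa [List.count_cons_self, Nat.add_comm, ← Nat.sub_sub]
    | some x =>
      rw [Quad.run] at h
      split_ifs at h with hx
      have hs (w : List State) (hw : wordOut w x = x) (u : List Letter) :
          ev w (x :: u) = x :: ev (reduce (wordNext w x)) u := by
        rw [ev_apply_cons, hw, ev_reduce]
      rw [List.count_cons_of_ne (by simp)]
      refine ih h (iterate_shiftQuot_section (x := x) ?_ hc)
      exact forall_zmod_four (hs _ hx.1) (hs _ hx.2.1) (hs _ hx.2.2.1) (hs _ hx.2.2.2)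

/-- Four words that are reproduced by nine commutations and several sections. -/
def periodicQuad : Quad := ([], [.d], [.c, .a], [.a, .b])

/-- Four words for elements of `branchSubgroup` that lead to `periodicQuad`. -/
def initialQuad : Quad :=
  ([.d, .a, .b, .a, .c], [.c, .a, .b, .a, .d], [], [.a, .b, .a, .b])

theorem run_periodicQuad :
    periodicQuad.run [none, none, none, some .one, none, none, some .one, none, some .one, none,
      none, some .one, none, some .two, some .one] = some periodicQuad := by
  decide +kernel

theorem run_initialQuad :
    initialQuad.run [some .two, none, none, none, none, some .one, none, none, some .one,
      some .one, some .one] = some periodicQuad := by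
  decide +kernel

/-- Descent: if c steps killed the quadruple, so would c - 9. -/
theorem iterate_shiftQuot_periodicQuad_ne (c : ℕ) : shiftQuot^[c] periodicQuad.toFun ≠ 1 := by
  induction c using Nat.strong_induction_on with
  | _ c ih =>
    intro h
    rcases Nat.eq_zero_or_pos c with rfl | hc
    -- The entry d sends 211 to 212.
    · have h1 : ev [.d] [.two, .one, .one] = [.two, .one, .one] :=
        congrArg (fun F => F 1 [.two, .one, .one]) h
      revert h1
      decide
    · exact ih _ (Nat.sub_lt hc (by decide)) (Quad.iterate_shiftQuot_run run_periodicQuad h)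

theorem iterate_shiftQuot_initialQuad_ne (c : ℕ) : shiftQuot^[c] initialQuad.toFun ≠ 1 :=
  fun h => iterate_shiftQuot_periodicQuad_ne _ (Quad.iterate_shiftQuot_run run_initialQuad h)

/-- The nontrivial entries are the conjugates of (ab)² by d and c, in reduced form, and (ab)²
itself. -/
theorem initialQuad_mem (i : ZMod 4) : initialQuad.toFun i ∈ branchSubgroup := by
  have h (q : State) (w : List State) (hw : reduce ([q] ++ branchWord ++ [q]) = reduce w) :
      ev w ∈ branchSubgroup := by
    have := conj_mem_branchSubgroup (ev_mem [q]) ev_branchWord_mem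
    rwa [ev_singleton, perm_inv, ← ev_singleton, ← ev_append, ← ev_append,
      ev_eq_of_reduce_eq hw] at this
  revert i
  exact forall_zmod_four (h .d _ (by decide)) (h .c _ (by decide)) (one_mem _) ev_branchWord_mem

/-! ### Elements of order at least four are not Engel -/

/-- On the `h`-orbit of the vertex `v`, the element `g` acts through the function `F`. -/
def Represents (h : Equiv.Perm (List Letter)) (v : List Letter) (g : Equiv.Perm (List Letter))
    (F : ZMod 4 → Equiv.Perm (List Letter)) : Prop :=
  ∀ (i : ℕ) (u : List Letter), g ((h ^ i) (v ++ u)) = (h ^ i) (v ++ F i u)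

/-- In these coordinates h is a pure shift of i, so h⁻¹gh acts through F(i+1). -/
theorem Represents.commutator {h g : Equiv.Perm (List Letter)} {v : List Letter}
    {F : ZMod 4 → Equiv.Perm (List Letter)} (hg : Represents h v g F) :
    Represents h v (g⁻¹ * h⁻¹ * g * h) (shiftQuot F) := by
  intro i u
  have h1 : h⁻¹ (g (h ((h ^ i) (v ++ u)))) = (h ^ i) (v ++ F (i + 1) u) := by
    rw [Equiv.Perm.inv_eq_iff_eq]
    have := hg (i + 1) u
    rwa [pow_succ', Equiv.Perm.mul_apply, Equiv.Perm.mul_apply, Nat.cast_succ] at this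
  simp only [Equiv.Perm.mul_apply, h1]
  rw [Equiv.Perm.inv_eq_iff_eq, hg, shiftQuot, Equiv.Perm.mul_apply, apply_inv_self]

theorem Represents.eq_one {h : Equiv.Perm (List Letter)} {v : List Letter}
    {F : ZMod 4 → Equiv.Perm (List Letter)} (hg : Represents h v 1 F) : F = 1 := by
  ext1 i; ext1 u
  have := hg i.val u
  rw [ZMod.natCast_zmod_val] at this
  exact (List.append_cancel_left ((h ^ i.val).injective this)).symm

/-- The vertices hⁿv, n < M, have disjoint subtrees, so the elements planting F(n) below v,
conjugated by hⁿ, do not interfere and can be multiplied. -/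
theorem exists_represents {h : Equiv.Perm (List Letter)} (hh : h ∈ grigorchukGroup) {M : ℕ}
    (hM : h ^ M = 1) (hM0 : 0 < M) (h4 : 4 ∣ M) {v : List Letter}
    (hv : ∀ d, 0 < d → d < M → (h ^ d) v ≠ v) {F : ZMod 4 → Equiv.Perm (List Letter)}
    (hF : ∀ i, F i ∈ branchSubgroup) : ∃ g ∈ grigorchukGroup, Represents h v g F := by
  have hlt {i j : ℕ} (hij : i < j) (hj : j < M) : (h ^ i) v ≠ (h ^ j) v := by
    intro he
    refine hv (j - i) (by omega) (by omega) ?_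
    apply (h ^ i).injective
    rw [← Equiv.Perm.mul_apply, ← pow_add, Nat.add_sub_cancel' hij.le, he]
  have hne {i j : ℕ} (hij : i ≠ j) (hi : i < M) (hj : j < M) : ((h ^ j)⁻¹ * h ^ i) v ≠ v := by
    rw [Equiv.Perm.mul_apply, Ne, Equiv.Perm.inv_eq_iff_eq]
    rcases hij.lt_or_gt with hij | hij
    exacts [hlt hij hj, (hlt hij hi).symm]
  have key (n : ℕ) (hn : n ≤ M) : ∃ g ∈ grigorchukGroup, ∀ i < M, ∀ u,
      g ((h ^ i) (v ++ u)) = (h ^ i) (v ++ if i < n then F i u else u) := by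
    induction n with
    | zero => exact ⟨1, one_mem _, fun i _ u => by simp⟩
    | succ n ih =>
      obtain ⟨g, hg, hgr⟩ := ih (by omega)
      obtain ⟨k, hk, hkv⟩ := exists_actsBelow (hF n) v
      refine ⟨h ^ n * k * (h ^ n)⁻¹ * g, mul_mem (mul_mem (mul_mem (pow_mem hh n)
        (branchSubgroup_le hk)) (inv_mem (pow_mem hh n))) hg, fun i hi u => ?_⟩
      rw [Equiv.Perm.mul_apply, hgr i hi, Equiv.Perm.mul_apply, Equiv.Perm.mul_apply]
      rcases eq_or_ne i n with rfl | hin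
      · simp only [lt_irrefl, if_false, Nat.lt_succ_self, if_true]
        rw [inv_apply_self, hkv.1]
      · rw [← Equiv.Perm.mul_apply (h ^ n)⁻¹, hkv.2 _ (not_prefix_apply
          (mul_mem (inv_mem (pow_mem hh n)) (pow_mem hh i)) (hne hin hi (by omega)) _),
          Equiv.Perm.mul_apply, apply_inv_self]
        simp only [show i < n + 1 ↔ i < n by omega]
  obtain ⟨g, hg, hgr⟩ := key M le_rfl
  refine ⟨g, hg, fun i u => ?_⟩
  have hi := Nat.mod_lt i hM0
  have := hgr (i % M) hi u
  rw [if_pos hi, ← pow_eq_pow_mod i hM] at this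
  -- As 4 ∣ M, going once around the orbit does not change the index of F.
  rwa [show ((i % M : ℕ) : ZMod 4) = i from
    (ZMod.natCast_eq_natCast_iff _ _ _).2 (Nat.mod_mod_of_dvd i h4)] at this

theorem not_isEngelElement {h : grigorchukGroup} (hh : h ^ 2 ≠ 1) : ¬ IsEngelElement h := by
  intro hE
  obtain ⟨h, hG⟩ := h
  replace hh : h ^ 2 ≠ 1 := fun he => hh (Subtype.ext he)
  have ht : ∃ k : ℕ, h ^ 2 ^ k = 1 := isTwoTorsion_of_mem hG
  classical
  obtain ⟨m, hm⟩ : ∃ m, Nat.find ht = m + 2 := by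
    refine ⟨Nat.find ht - 2, (Nat.sub_add_cancel ?_).symm⟩
    by_contra hlt
    exact hh (by simpa using IsTwoTorsion.pow_eq_one (l := 1) (Nat.find_spec ht) (by omega))
  have hM : h ^ 2 ^ (m + 2) = 1 := hm ▸ Nat.find_spec ht
  have hM' : h ^ 2 ^ (m + 1) ≠ 1 := Nat.find_min ht (by omega)
  -- A vertex moved by the last nontrivial 2-power of h has an orbit of full length 2^(m+2).
  obtain ⟨v, hv⟩ : ∃ v, (h ^ 2 ^ (m + 1)) v ≠ v := by
    by_contra! hc
    exact hM' (Equiv.ext hc)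
  have hper : Function.minimalPeriod h v = 2 ^ (m + 2) := by
    refine Function.minimalPeriod_eq_prime_pow (p := 2) (k := m + 1) ?_ ?_
    · rwa [Function.IsPeriodicPt, Function.IsFixedPt, ← Equiv.Perm.coe_pow]
    · rw [Function.IsPeriodicPt, Function.IsFixedPt, ← Equiv.Perm.coe_pow, hM]; rfl
  obtain ⟨g, hg, hgr⟩ := exists_represents hG hM (by positivity) ⟨2 ^ m, by ring⟩ (v := v)
    (fun d hd hdM hdv => by
      refine Function.not_isPeriodicPt_of_pos_of_lt_minimalPeriod hd.ne' (hper ▸ hdM) ?_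
      rwa [Function.IsPeriodicPt, Function.IsFixedPt, ← Equiv.Perm.coe_pow])
    initialQuad_mem
  have hrep (c : ℕ) : Represents h v (engelWord (⟨g, hg⟩ : grigorchukGroup) ⟨h, hG⟩ c).1
      (shiftQuot^[c] initialQuad.toFun) := by
    induction c with
    | zero => exact hgr
    | succ c ih =>
      rw [Function.iterate_succ_apply']
      exact ih.commutator
  obtain ⟨N, hN⟩ := hE ⟨g, hg⟩
  have := hrep N
  rw [hN N le_rfl] at this
  exact iterate_shiftQuot_initialQuad_ne N this.eq_one

theorem sq_ab_ne_one : (⟨ev [.a, .b], ev_mem _⟩ : grigorchukGroup) ^ 2 ≠ 1 := by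
  intro h
  have h1 : ev [.a, .b] (ev [.a, .b] [.one, .one]) = [.one, .one] :=
    congrArg (fun g : grigorchukGroup => g.1 [.one, .one]) ((sq _).symm.trans h)
  revert h1
  decide

end Grigorchuk

theorem theorem1 :
    ¬ IsEngelGroup grigorchukGroup ∧
      ∀ h : grigorchukGroup, IsEngelElement h ↔ h ^ 2 = 1 :=
  ⟨fun hG => Grigorchuk.not_isEngelElement Grigorchuk.sq_ab_ne_one fun g => hG g _,
    fun _ => ⟨fun hE => by_contra fun hh => Grigorchuk.not_isEngelElement hh hE,
      isEngelElement_of_sq_eq_one⟩⟩
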